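/- Let $n\ge 2$. Let $\psi:\mathbf R\to\mathbf R$ and $\varphi:\mathbf R^n\to\mathbf R$ be smooth functions supported in $\{1/2\le |t|\le 2\}$ and in $\{1/2\le|\xi|\le 2\}$ respectively (for instance the one-dimensional and $n$-dimensional Littlewood--Paley cutoffs), and let $\hat f(\xi)=\int f(x)e^{-2\pi i x\cdot\xi}\,dx$, extended to $L^2(\mathbf R^n)$ by Plancherel. For $m\in\mathbf Z$ and $f\in L^2(\mathbf R^n)$ define the maximal "thin big circle" multiplier operator $$T_m f(x)=\sup_{u\in\mathbf S^{n-1}}\Big|\int_{\mathbf R^n}\psi\big(2^m\langle u,\xi/|\xi|\rangle\big)\,\varphi(\xi)\,\hat f(\xi)\,e^{2\pi i\xi\cdot x}\,d\xi\Big| .$$ Then there is a constant $C$, depending only on $n,\psi,\varphi$, such that for all $m\in\mathbf Z$ $$\|T_m\|_{L^2(\mathbf R^n)\to L^2(\mathbf R^n)}\le C\,2^{m(n/2-1)} .$$ Moreover, for every $\delta>n/2-1$ the smoothed maximal directional Hilbert transform $$H^*_\delta f(x)=\sup_{u\in\mathbf S^{n-1}}\Big|\int_{\mathbf R^n}\langle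 u,\xi/|\xi|\rangle_+^{\delta}\,\varphi(\xi)\,\hat f(\xi)\,e^{2\pi i\xi\cdot x}\,d\xi\Big|$$ is bounded on $L^2(\mathbf R^n)$, with $$\|H^*_\delta\|_{L^2(\mathbf R^n)\to L^2(\mathbf R^n)}\le C_\delta\,2^{n/2-1},$$ where $C_\delta$ depends only on $n,\varphi,\delta$. -/

import Mathlib

open MeasureTheory
open scoped ENNReal FourierTransform ContDiff

/-- A smooth real cutoff supported in the closed annulus `1/2 ≤ |ξ| ≤ 2`. It is used both on the
real line and on `ℝⁿ`. -/
structure IsAnnulusCutoff {E : Type*} [NormedAddCommGroup E] [NormedSpace ℝ E] (φ : E → ℝ) :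
    Prop where
  contDiff : ContDiff ℝ ∞ φ
  support_subset : Function.support φ ⊆ {ξ | 1 / 2 ≤ ‖ξ‖ ∧ ‖ξ‖ ≤ 2}

/-- The Fourier integral `∫ σ(ξ) φ(ξ) f̂(ξ) e^{2πi ξ·x} dξ` for `f ∈ L²(ℝⁿ)`, where `f̂` is the
Plancherel-extended Fourier transform normalised by `f̂(ξ) = ∫ f(x) e^{-2πi x·ξ} dx`. -/
noncomputable def localizedMultiplier {n : ℕ} (φ : EuclideanSpace ℝ (Fin n) → ℝ)
    (σ : EuclideanSpace ℝ (Fin n) → ℝ)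
    (f : Lp ℂ 2 (volume : Measure (EuclideanSpace ℝ (Fin n))))
    (x : EuclideanSpace ℝ (Fin n)) : ℂ :=
  ∫ ξ, (σ ξ : ℂ) * (φ ξ : ℂ) * (𝓕 f) ξ *
    Complex.exp (2 * (Real.pi : ℂ) * Complex.I * ((inner ℝ ξ x : ℝ) : ℂ))

/-- The maximal "thin big circle" operator
`T_m f(x) = sup_{|u|=1} |∫ ψ(2^m ⟨u, ξ/|ξ|⟩) φ(ξ) f̂(ξ) e^{2πi ξ·x} dξ|`, where `ψ` is the cutoff
on the line and `φ` is the cutoff on `ℝⁿ`. -/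
noncomputable def thinBigCircleMax {n : ℕ} (ψ : ℝ → ℝ) (φ : EuclideanSpace ℝ (Fin n) → ℝ)
    (m : ℤ) (f : Lp ℂ 2 (volume : Measure (EuclideanSpace ℝ (Fin n))))
    (x : EuclideanSpace ℝ (Fin n)) : ℝ≥0∞ :=
  ⨆ u : Metric.sphere (0 : EuclideanSpace ℝ (Fin n)) 1,
    ‖localizedMultiplier φ
      (fun ξ => ψ ((2 : ℝ) ^ m * inner ℝ (u : EuclideanSpace ℝ (Fin n)) (‖ξ‖⁻¹ • ξ))) f x‖ₑ

/-- The smoothed maximal directional Hilbert transform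
`H^*_δ f(x) = sup_{|u|=1} |∫ ⟨u, ξ/|ξ|⟩_+^δ φ(ξ) f̂(ξ) e^{2πi ξ·x} dξ|`. -/
noncomputable def smoothedDirectionalHilbertMax {n : ℕ} (φ : EuclideanSpace ℝ (Fin n) → ℝ)
    (δ : ℝ) (f : Lp ℂ 2 (volume : Measure (EuclideanSpace ℝ (Fin n))))
    (x : EuclideanSpace ℝ (Fin n)) : ℝ≥0∞ :=
  ⨆ u : Metric.sphere (0 : EuclideanSpace ℝ (Fin n)) 1,
    ‖localizedMultiplier φ
      (fun ξ => (max (inner ℝ (u : EuclideanSpace ℝ (Fin n)) (‖ξ‖⁻¹ • ξ)) 0) ^ δ) f x‖ₑ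

/-- The sublinear operator `T`, with values in extended nonnegative functions, is bounded on
`L²(ℝⁿ)` with norm at most `A`; measurability of `T f` is part of the claim. -/
def L2NormLE {n : ℕ}
    (T : Lp ℂ 2 (volume : Measure (EuclideanSpace ℝ (Fin n))) →
      EuclideanSpace ℝ (Fin n) → ℝ≥0∞) (A : ℝ) : Prop :=
  ∀ f : Lp ℂ 2 (volume : Measure (EuclideanSpace ℝ (Fin n))),
    Measurable (T f) ∧ eLpNorm (T f) 2 volume ≤ ENNReal.ofReal (A * ‖f‖)

/-! The maximal bound is an $L^2$ Sobolev embedding in the parameter. Replace $2^m u$ by an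
arbitrary $w\in\mathbf R^n$ and let $F_w$ be the inverse transform of
$\prod_i(1+\partial_{w_i})[\psi(\langle w,\xi/|\xi|\rangle)]\,g(\xi)$ with $g=\varphi\hat f$.
Convolving in $w$ with the product of one-sided exponentials inverts the differential operator
(`integral_prod_expKernel_mul`). Cauchy–Schwarz then bounds the value at $v$ squared by $\int
e^{-|v-w|}|F_w(x)|^2\,dw$, and $|v-w|\ge||w|-|v||$ gives a majorant depending on $v$ only through
$|v|$ (`enorm_fourierInv_mul_sq_le`). It therefore dominates the supremum over $|v|=R=2^m$.

Integrate in $x$ and apply Plancherel for each $w$. For fixed $\xi$ the symbol is bounded and lives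
in the slab $|\langle w,\xi/|\xi|\rangle|\le2$, where the weight $e^{-||w|-R|}$ has mass
$O(R^{n-2})$ (`exists_lintegral_slab_le`): a bounded neighbourhood of an $(n-2)$-sphere of radius
$R$. The square root is $2^{m(n/2-1)}$.

For $H^*_\delta$, $t_+^\delta$ on $t\le1$ is a sum of dyadic pieces $2^{-m\delta}\psi_\delta(2^mt)$,
$m\ge0$ (`tendsto_sum_range_dyadicPower`); the resulting norms form a geometric series of ratio
$2^{n/2-1-\delta}<1$. -/

section Plancherel

/-! ### Plancherel for the inverse Fourier integral on $L^1\cap L^2$. -/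

variable {V : Type*} [NormedAddCommGroup V] [InnerProductSpace ℝ V] [FiniteDimensional ℝ V]
  [MeasurableSpace V] [BorelSpace V]

theorem integral_fourierInv_mul_eq {f g : V → ℂ} (hf : Integrable f) (hg : Integrable g) :
    ∫ x, 𝓕⁻ f x * g x = ∫ x, f x * 𝓕⁻ g x := by
  have hL : Continuous fun p : V × V => (-innerₗ V) p.1 p.2 := by
    simp only [LinearMap.neg_apply, innerₗ_apply_apply]
    fun_prop
  have h := VectorFourier.integral_fourierIntegral_smul_eq_flip (L := -innerₗ V)
    Real.continuous_fourierChar hL hf hg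
  have hflip : (-innerₗ V).flip = -innerₗ V := by
    ext x y
    simp [real_inner_comm]
  rw [hflip] at h
  simp only [smul_eq_mul] at h
  exact h

/-- The inverse Fourier transform on `L²` is given by the integral on `L¹ ∩ L²`. -/
theorem fourierInv_toLp_ae_eq {h : V → ℂ} (h1 : Integrable h) (h2 : MemLp h 2) :
    ((𝓕⁻ (h2.toLp h) : Lp ℂ 2 (volume : Measure V)) : V → ℂ) =ᵐ[volume] 𝓕⁻ h := by
  have hcont : Continuous (𝓕⁻ h) :=
    VectorFourier.fourierIntegral_continuous (L := -innerₗ V) Real.continuous_fourierChar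
      (by simp only [LinearMap.neg_apply, innerₗ_apply_apply]; fun_prop) h1
  refine ae_eq_of_integral_contDiff_smul_eq ?_ hcont.locallyIntegrable ?_
  · exact (Lp.memLp _).locallyIntegrable (by norm_num)
  intro g hg hgc
  have hgc' : HasCompactSupport (fun x => (g x : ℂ)) := hgc.comp_left (g := fun t : ℝ => (t : ℂ)) rfl
  have hg' : ContDiff ℝ ∞ (fun x => (g x : ℂ)) := Complex.ofRealCLM.contDiff.comp hg
  let G : SchwartzMap V ℂ := hgc'.toSchwartzMap hg'
  have hG : ∀ x, G x = (g x : ℂ) := fun x => rfl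
  -- Both sides are tested against $G$: the $L^2$ transform is compatible with the distributional
  -- one, which moves onto $G$, and Fubini does the same for the integral.
  have e1 := congrArg (fun T => T G) (Lp.fourierInv_toTemperedDistribution_eq (h2.toLp h))
  simp only [TemperedDistribution.fourierInv_apply, Lp.toTemperedDistribution_apply, hG] at e1
  have e2 : ∫ x, g x • (𝓕⁻ h) x = ∫ x, (𝓕⁻ G) x • h x := by
    have := integral_fourierInv_mul_eq G.integrable h1
    simp only [smul_eq_mul, Complex.real_smul]
    rw [SchwartzMap.fourierInv_coe]
    exact this.symm
  simp only [Complex.real_smul, smul_eq_mul] at e1 e2 ⊢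
  rw [e2, ← e1]
  refine integral_congr_ae ?_
  filter_upwards [h2.coeFn_toLp] with x hx
  rw [hx]

theorem lintegral_enorm_fourierInv_sq {h : V → ℂ} (h1 : Integrable h) (h2 : MemLp h 2) :
    ∫⁻ x, ‖𝓕⁻ h x‖ₑ ^ 2 = ∫⁻ x, ‖h x‖ₑ ^ 2 := by
  have key : eLpNorm (𝓕⁻ h) 2 volume = eLpNorm h 2 volume := by
    rw [← eLpNorm_congr_ae (fourierInv_toLp_ae_eq h1 h2), ← eLpNorm_congr_ae h2.coeFn_toLp,
      ← Lp.enorm_def, ← Lp.enorm_def]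
    have := Lp.norm_fourier_eq (𝓕⁻ (h2.toLp h))
    rw [FourierTransform.fourier_fourierInv_eq] at this
    rw [enorm_eq_iff_norm_eq, this]
  have e := fun f : V → ℂ => eLpNorm_nnreal_pow_eq_lintegral (f := f) (μ := volume) (p := 2) two_ne_zero
  have e1 := e (𝓕⁻ h)
  have e2 := e h
  simp only [NNReal.coe_ofNat, ENNReal.coe_ofNat, ENNReal.rpow_ofNat] at e1 e2
  rw [← e1, ← e2, key]

end Plancherel

/-! ### Mass of the exponential weight near a sphere and in a slab. -/

/-- With $M=4k+4$, $1+2|s|\le Me^{2|s|/M}$, so the $k$-th power costs at most $M^ke^{|s|/2}$ and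
half of the exponential decay survives. -/
theorem integrable_one_add_abs_pow_mul_exp (k : ℕ) :
    Integrable fun s : ℝ => (1 + 2 * |s|) ^ k * Real.exp (-|s|) := by
  have hexp : Integrable fun s : ℝ => Real.exp (-(1 / 2) * ‖s‖) := by
    rw [integrable_fun_norm_addHaar volume (f := fun s : ℝ => Real.exp (-(1 / 2) * s))]
    simpa using exp_neg_integrableOn_Ioi 0 (b := 1 / 2) (by norm_num)
  have hM : (0 : ℝ) < 4 * k + 4 := by positivity
  refine (hexp.const_mul ((4 * k + 4 : ℝ) ^ k)).mono' (by fun_prop) (.of_forall fun s => ?_)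
  rw [Real.norm_of_nonneg (by positivity)]
  have h1 : 1 + 2 * |s| ≤ (4 * k + 4) * Real.exp (2 * |s| / (4 * k + 4)) := by
    have := Real.add_one_le_exp (2 * |s| / (4 * k + 4))
    calc 1 + 2 * |s| ≤ (4 * k + 4) + 2 * |s| := by linarith [(Nat.cast_nonneg k : (0 : ℝ) ≤ k)]
      _ = (4 * k + 4) * (2 * |s| / (4 * k + 4) + 1) := by field_simp; ring
      _ ≤ _ := by gcongr
  have h2 : k * (2 * |s| / (4 * k + 4)) ≤ 1 / 2 * |s| := by
    rw [mul_div_assoc', div_le_iff₀ hM]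
    nlinarith [abs_nonneg s, mul_nonneg (Nat.cast_nonneg (α := ℝ) k) (abs_nonneg s)]
  calc (1 + 2 * |s|) ^ k * Real.exp (-|s|)
      ≤ ((4 * k + 4) * Real.exp (2 * |s| / (4 * k + 4))) ^ k * Real.exp (-|s|) := by gcongr
    _ = (4 * k + 4 : ℝ) ^ k * Real.exp (k * (2 * |s| / (4 * k + 4)) + -|s|) := by
        rw [mul_pow, ← Real.exp_nat_mul, Real.exp_add, mul_assoc]
    _ ≤ (4 * k + 4 : ℝ) ^ k * Real.exp (-(1 / 2) * ‖s‖) := by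
        gcongr
        rw [Real.norm_eq_abs]
        linarith

/-- Since $R\ge1/2$, $y\le R+|y-R|\le R(1+2|y-R|)$. This extracts $R^k$ from the polar Jacobian. -/
theorem pow_mul_exp_neg_abs_sub_le (k : ℕ) {R y : ℝ} (hR : 1 / 2 ≤ R) (hy : 0 ≤ y) :
    y ^ k * Real.exp (-|y - R|) ≤ R ^ k * ((1 + 2 * |y - R|) ^ k * Real.exp (-|y - R|)) := by
  rw [← mul_assoc, ← mul_pow]
  gcongr
  nlinarith [abs_nonneg (y - R), le_abs_self (y - R)]

/-- The exponential weight around the sphere of radius `R` has mass of the order of its area. -/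
theorem exists_lintegral_exp_neg_abs_norm_sub_le (k : ℕ) :
    ∃ C : ℝ, 0 < C ∧ ∀ R : ℝ, 1 / 2 ≤ R →
      ∫⁻ y : EuclideanSpace ℝ (Fin (k + 1)), ENNReal.ofReal (Real.exp (-|‖y‖ - R|)) ≤
        ENNReal.ofReal (C * R ^ k) := by
  set I := ∫ s : ℝ, (1 + 2 * |s|) ^ k * Real.exp (-|s|)
  set D := (k + 1 : ℝ) * (volume : Measure (EuclideanSpace ℝ (Fin (k + 1)))).real (Metric.ball 0 1)
    with hD
  have hI0 : 0 ≤ I := integral_nonneg fun s => by positivity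
  have hD0 : 0 ≤ D := by positivity
  -- `D` is the area of the unit sphere, from polar coordinates; the `+ 1` only secures positivity.
  refine ⟨D * I + 1, by positivity, fun R hR => ?_⟩
  have hint : Integrable fun y : ℝ => (1 + 2 * |y - R|) ^ k * Real.exp (-|y - R|) :=
    (integrable_one_add_abs_pow_mul_exp k).comp_sub_right R
  have hint2 : IntegrableOn (fun y : ℝ => y ^ k • Real.exp (-|y - R|)) (Set.Ioi 0) := by
    refine ((hint.const_mul (R ^ k)).integrableOn).mono' (by fun_prop) ?_
    filter_upwards [ae_restrict_mem measurableSet_Ioi] with y hy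
    have hy : 0 < y := hy
    rw [smul_eq_mul, Real.norm_of_nonneg (by positivity)]
    exact pow_mul_exp_neg_abs_sub_le k hR hy.le
  have hint3 : Integrable fun y : EuclideanSpace ℝ (Fin (k + 1)) => Real.exp (-|‖y‖ - R|) := by
    rw [integrable_fun_norm_addHaar volume (f := fun y : ℝ => Real.exp (-|y - R|))]
    simpa using hint2
  rw [← ofReal_integral_eq_lintegral_ofReal hint3 (.of_forall fun _ => by positivity)]
  refine ENNReal.ofReal_le_ofReal ?_
  rw [integral_fun_norm_addHaar volume (fun y : ℝ => Real.exp (-|y - R|))]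
  have hle : ∫ y in Set.Ioi (0 : ℝ), y ^ k • Real.exp (-|y - R|) ≤ R ^ k * I := by
    calc _ ≤ ∫ y in Set.Ioi (0 : ℝ), R ^ k * ((1 + 2 * |y - R|) ^ k * Real.exp (-|y - R|)) :=
          setIntegral_mono_on hint2 (hint.const_mul _).integrableOn measurableSet_Ioi
            fun y hy => pow_mul_exp_neg_abs_sub_le k hR (le_of_lt hy)
      _ ≤ ∫ y, R ^ k * ((1 + 2 * |y - R|) ^ k * Real.exp (-|y - R|)) :=
          setIntegral_le_integral (hint.const_mul _) (.of_forall fun y => by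
            have : 0 ≤ R := by linarith
            positivity)
      _ = R ^ k * I := by
          rw [integral_const_mul, integral_sub_right_eq_self
            (fun y => (1 + 2 * |y|) ^ k * Real.exp (-|y|)) R]
  have hRk : 0 ≤ R ^ k := pow_nonneg (by linarith) k
  simp only [finrank_euclideanSpace, Fintype.card_fin, add_tsub_cancel_right]
  rw [nsmul_eq_mul, smul_eq_mul, ← mul_assoc]
  push_cast
  rw [← hD]
  nlinarith [mul_le_mul_of_nonneg_left hle hD0]

/-- By Pythagoras; in the slab it lets the weight on $\mathbf R^{k+1}$ be compared with the weight
on the hyperplane $\mathbf R^k$. -/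
theorem abs_norm_toLp_cons_sub_le {k : ℕ} (t : ℝ) (y : Fin k → ℝ) :
    |‖WithLp.toLp 2 (Fin.cons t y : Fin (k + 1) → ℝ)‖ - ‖WithLp.toLp 2 y‖| ≤ |t| := by
  set a := ‖WithLp.toLp 2 (Fin.cons t y : Fin (k + 1) → ℝ)‖
  set b := ‖WithLp.toLp 2 y‖
  have ha : 0 ≤ a := norm_nonneg _
  have hb : 0 ≤ b := norm_nonneg _
  have h : a ^ 2 = |t| ^ 2 + b ^ 2 := by
    simp only [a, b, EuclideanSpace.norm_sq_eq, Fin.sum_univ_succ]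
    simp
  rw [abs_le]
  constructor <;> nlinarith [abs_nonneg t]

/-- The part of the exponential weight around the sphere of radius `R` which lies in a slab of
bounded width. -/
theorem exists_lintegral_slab_le {n : ℕ} (hn : 2 ≤ n) :
    ∃ C : ℝ, 0 < C ∧ ∀ R : ℝ, 1 / 2 ≤ R → ∀ θ : EuclideanSpace ℝ (Fin n), ‖θ‖ = 1 →
      ∫⁻ w in {w : EuclideanSpace ℝ (Fin n) | |inner ℝ w θ| ≤ 2},
        ENNReal.ofReal (Real.exp (-|‖w‖ - R|)) ≤ ENNReal.ofReal (C * R ^ (n - 2)) := by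
  obtain ⟨k, rfl⟩ := Nat.exists_eq_add_of_le' hn
  obtain ⟨C, hC, hCR⟩ := exists_lintegral_exp_neg_abs_norm_sub_le k
  refine ⟨4 * Real.exp 2 * C, by positivity, fun R hR θ hθ => ?_⟩
  let e : EuclideanSpace ℝ (Fin (k + 2)) := EuclideanSpace.single 0 1
  -- A reflection taking `θ` to the first basis vector preserves the volume and the radial weight,
  -- so the slab becomes $|w_0|\le2$.
  let L := (ℝ ∙ (θ - e))ᗮ.reflection
  have hL : L θ = e := Submodule.reflection_sub (by simp [e, hθ])
  set W : EuclideanSpace ℝ (Fin (k + 2)) → ℝ≥0∞ := fun w =>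
    {w : EuclideanSpace ℝ (Fin (k + 2)) | |w 0| ≤ 2}.indicator
      (fun w => ENNReal.ofReal (Real.exp (-|‖w‖ - R|))) w with hW
  have hS' : MeasurableSet {w : EuclideanSpace ℝ (Fin (k + 2)) | |inner ℝ w θ| ≤ 2} :=
    measurableSet_le (by fun_prop) (by fun_prop)
  have hin : ∀ w, inner ℝ w θ = (L w) 0 := fun w => by
    rw [← L.inner_map_map, hL, EuclideanSpace.inner_single_right]
    simp
  calc ∫⁻ w in {w : EuclideanSpace ℝ (Fin (k + 2)) | |inner ℝ w θ| ≤ 2},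
        ENNReal.ofReal (Real.exp (-|‖w‖ - R|))
      = ∫⁻ w, W (L w) := by
        rw [← lintegral_indicator hS']
        refine lintegral_congr fun w => ?_
        simp only [hW, Set.indicator, Set.mem_ofPred_eq, hin, L.norm_map]
    _ = ∫⁻ w, W w := L.measurePreserving.lintegral_comp_emb
        L.toHomeomorph.measurableEmbedding W
    _ = ∫⁻ y : Fin (k + 2) → ℝ, W (WithLp.toLp 2 y) :=
        ((PiLp.volume_preserving_toLp (Fin (k + 2))).lintegral_comp_emb
          (MeasurableEquiv.toLp 2 _).measurableEmbedding W).symm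
    _ = ∫⁻ p : ℝ × (Fin (k + 1) → ℝ), W (WithLp.toLp 2 (Fin.cons p.1 p.2)) := by
        rw [← (volume_preserving_piFinSuccAbove (fun _ : Fin (k + 2) => ℝ) 0).symm.lintegral_comp_emb
          (MeasurableEquiv.measurableEmbedding _) (fun y => W (WithLp.toLp 2 y))]
        refine lintegral_congr fun p => ?_
        congr 2
        exact Fin.insertNth_zero' p.1 p.2
    -- Dropping $w_0$ moves the norm by at most 2, hence the factor $e^2$; the factor 4 below is the
    -- length of $[-2,2]$. What remains is the weight on $\mathbf R^{k+1}$, of mass $O(R^k)$ with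
    -- $k=n-2$.
    _ ≤ ∫⁻ p : ℝ × (Fin (k + 1) → ℝ), (Set.Icc (-2 : ℝ) 2).indicator 1 p.1 *
          (ENNReal.ofReal (Real.exp 2) *
            ENNReal.ofReal (Real.exp (-|‖WithLp.toLp 2 p.2‖ - R|))) := by
        refine lintegral_mono fun p => ?_
        simp only [hW, Set.indicator, Set.mem_ofPred_eq, Set.mem_Icc, ← abs_le, Fin.cons_zero]
        split_ifs with h
        · simp only [Pi.one_apply, one_mul]
          rw [← ENNReal.ofReal_mul (by positivity), ← Real.exp_add]
          refine ENNReal.ofReal_le_ofReal (Real.exp_le_exp.2 ?_)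
          have h1 := abs_norm_toLp_cons_sub_le p.1 p.2
          have h2 := abs_sub_le ‖WithLp.toLp 2 p.2‖
            ‖WithLp.toLp 2 (Fin.cons p.1 p.2 : Fin (k + 2) → ℝ)‖ R
          rw [abs_sub_comm] at h1
          linarith
        · simp
    _ = 4 * (ENNReal.ofReal (Real.exp 2) *
          ∫⁻ y : EuclideanSpace ℝ (Fin (k + 1)), ENNReal.ofReal (Real.exp (-|‖y‖ - R|))) := by
        rw [Measure.volume_eq_prod, lintegral_prod_mul (f := (Set.Icc (-2 : ℝ) 2).indicator 1)
          (g := fun y : Fin (k + 1) → ℝ => ENNReal.ofReal (Real.exp 2) *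
            ENNReal.ofReal (Real.exp (-|‖WithLp.toLp 2 y‖ - R|)))
          ((measurable_one.indicator measurableSet_Icc).aemeasurable) (by fun_prop),
          lintegral_indicator_one measurableSet_Icc, lintegral_const_mul _ (by fun_prop),
          ← (PiLp.volume_preserving_toLp (Fin (k + 1))).lintegral_comp_emb
          (MeasurableEquiv.toLp 2 _).measurableEmbedding, Real.volume_Icc]
        norm_num
    _ ≤ 4 * (ENNReal.ofReal (Real.exp 2) * ENNReal.ofReal (C * R ^ k)) := by
        gcongr
        exact hCR R hR
    _ = ENNReal.ofReal (4 * Real.exp 2 * C * R ^ (k + 2 - 2)) := by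
        rw [← ENNReal.ofReal_mul (by positivity), ← ENNReal.ofReal_ofNat,
          ← ENNReal.ofReal_mul (by positivity)]
        congr 1
        simp only [add_tsub_cancel_right]
        ring

/-! ### Reconstruction of a cutoff from exponential averages. -/

namespace IsAnnulusCutoff

variable {E : Type*} [NormedAddCommGroup E] [NormedSpace ℝ E] {φ : E → ℝ}

theorem hasCompactSupport [FiniteDimensional ℝ E] (hφ : IsAnnulusCutoff φ) :
    HasCompactSupport φ :=
  have : ProperSpace E := FiniteDimensional.proper ℝ E
  HasCompactSupport.intro (isCompact_closedBall 0 2) fun x hx => by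
    by_contra h
    exact hx (by simpa using (hφ.support_subset h).2)

theorem exists_abs_le [FiniteDimensional ℝ E] (hφ : IsAnnulusCutoff φ) :
    ∃ B, 0 ≤ B ∧ ∀ x, |φ x| ≤ B := by
  obtain ⟨B, hB⟩ := hφ.contDiff.continuous.bounded_above_of_compact_support hφ.hasCompactSupport
  exact ⟨B, (norm_nonneg _).trans (hB 0), hB⟩

theorem deriv {ψ : ℝ → ℝ} (hψ : IsAnnulusCutoff ψ) : IsAnnulusCutoff (deriv ψ) where
  contDiff := ((contDiff_infty_iff_deriv (𝕜 := ℝ)).1 hψ.contDiff).2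
  support_subset := by
    refine support_deriv_subset.trans (closure_minimal hψ.support_subset ?_)
    exact (isClosed_le continuous_const continuous_norm).inter
      (isClosed_le continuous_norm continuous_const)

end IsAnnulusCutoff

/-- The one-sided exponential density. -/
noncomputable def expKernel (t : ℝ) : ℝ := (Set.Ioi 0).indicator (fun t => Real.exp (-t)) t

theorem expKernel_nonneg (t : ℝ) : 0 ≤ expKernel t :=
  Set.indicator_nonneg (fun _ _ => (Real.exp_pos _).le) t

theorem measurable_expKernel : Measurable expKernel :=
  (by fun_prop : Measurable fun t : ℝ => Real.exp (-t)).indicator measurableSet_Ioi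

theorem integrable_expKernel : Integrable expKernel := by
  have h := exp_neg_integrableOn_Ioi 0 (b := 1) one_pos
  simp only [neg_mul, one_mul] at h
  exact (integrable_indicator_iff measurableSet_Ioi).2 h

theorem integral_expKernel_mul (h : ℝ → ℝ) :
    ∫ t, expKernel t * h t = ∫ t in Set.Ioi 0, Real.exp (-t) * h t := by
  rw [← integral_indicator measurableSet_Ioi]
  refine integral_congr_ae (.of_forall fun t => ?_)
  simp only [expKernel, Set.indicator]
  split_ifs <;> simp

theorem integral_expKernel : ∫ t, expKernel t = 1 := by
  have h := integral_expKernel_mul fun _ => 1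
  simp only [mul_one] at h
  rw [h, integral_exp_neg_Ioi_zero]

/-- A function is recovered from `h + a h'` by averaging against the exponential density. -/
theorem integral_expKernel_mul_add_deriv {h : ℝ → ℝ} (hh : IsAnnulusCutoff h) (a s : ℝ) :
    ∫ t, expKernel t * (h (s - a * t) + a * deriv h (s - a * t)) = h s := by
  obtain ⟨B, -, hB⟩ := hh.exists_abs_le
  obtain ⟨B', -, hB'⟩ := hh.deriv.exists_abs_le
  have hc := hh.contDiff.continuous
  have hc' := hh.deriv.contDiff.continuous
  have hexp : IntegrableOn (fun t : ℝ => Real.exp (-t)) (Set.Ioi 0) := by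
    simpa using exp_neg_integrableOn_Ioi 0 (b := 1) one_pos
  rw [integral_expKernel_mul]
  -- The integrand is an exact derivative; the primitive vanishes at infinity and equals $-h(s)$ at
  -- $0$.
  have hderiv : ∀ t ∈ Set.Ici (0 : ℝ), HasDerivAt (fun t => -(Real.exp (-t) * h (s - a * t)))
      (Real.exp (-t) * (h (s - a * t) + a * deriv h (s - a * t))) t := by
    intro t _
    have h1 : HasDerivAt (fun t : ℝ => s - a * t) (-a) t := by
      simpa using ((hasDerivAt_id t).const_mul a).const_sub s
    have h2 := ((hh.contDiff.differentiable (by simp)).differentiableAt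
      (x := s - a * t)).hasDerivAt.comp t h1
    have h3 : HasDerivAt (fun t : ℝ => Real.exp (-t)) (-Real.exp (-t)) t := by
      simpa using (hasDerivAt_neg t).exp
    refine (h3.mul h2).neg.congr_deriv ?_
    simp only [Function.comp_apply]
    ring
  have hlim : Filter.Tendsto (fun t => -(Real.exp (-t) * h (s - a * t))) Filter.atTop
      (nhds 0) := by
    refine squeeze_zero_norm (a := fun t => Real.exp (-t) * B) (fun t => ?_) ?_
    · rw [norm_neg, norm_mul, Real.norm_of_nonneg (Real.exp_pos _).le]
      gcongr
      exact hB _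
    · simpa using Real.tendsto_exp_neg_atTop_nhds_zero.mul_const B
  have hint : IntegrableOn
      (fun t => Real.exp (-t) * (h (s - a * t) + a * deriv h (s - a * t))) (Set.Ioi 0) := by
    refine (hexp.mul_const (B + |a| * B')).mono' (by fun_prop) (.of_forall fun t => ?_)
    rw [norm_mul, Real.norm_of_nonneg (Real.exp_pos _).le]
    gcongr
    refine (norm_add_le _ _).trans (add_le_add (hB _) ?_)
    rw [norm_mul]
    exact mul_le_mul_of_nonneg_left (hB' _) (abs_nonneg a)
  rw [integral_Ioi_of_hasDerivAt_of_tendsto' hderiv hint hlim]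
  simp

/-- The differential operator `∏ i, (1 + a i ∂)` on the line. -/
noncomputable def prodOneAddDeriv : (n : ℕ) → (Fin n → ℝ) → (ℝ → ℝ) → ℝ → ℝ
  | 0, _, ψ, s => ψ s
  | n + 1, a, ψ, s => prodOneAddDeriv n (Fin.tail a) ψ s +
      a 0 * prodOneAddDeriv n (Fin.tail a) (deriv ψ) s

/-- Joint continuity matters because the coefficients will be the coordinates of $\xi/|\xi|$; it
yields the joint measurability behind Tonelli. -/
theorem continuous_prodOneAddDeriv (n : ℕ) {ψ : ℝ → ℝ} (hψ : IsAnnulusCutoff ψ) :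
    Continuous fun p : (Fin n → ℝ) × ℝ => prodOneAddDeriv n p.1 ψ p.2 := by
  induction n generalizing ψ with
  | zero => exact hψ.contDiff.continuous.comp continuous_snd
  | succ n ih =>
    have ht : Continuous fun p : (Fin (n + 1) → ℝ) × ℝ => (Fin.tail p.1, p.2) := by
      unfold Fin.tail
      fun_prop
    have h1 := (ih hψ).comp ht
    have h2 := (ih hψ.deriv).comp ht
    have h3 : Continuous fun p : (Fin (n + 1) → ℝ) × ℝ => p.1 0 := by fun_prop
    exact h1.add (h3.mul h2)

/-- Differentiation does not enlarge the support; this is what confines $w$ to the slab. -/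
theorem prodOneAddDeriv_eq_zero (n : ℕ) {ψ : ℝ → ℝ} (hψ : IsAnnulusCutoff ψ) (a : Fin n → ℝ)
    {s : ℝ} (hs : 2 < |s|) : prodOneAddDeriv n a ψ s = 0 := by
  induction n generalizing ψ with
  | zero =>
    by_contra h
    exact hs.not_ge (hψ.support_subset h).2
  | succ n ih => simp [prodOneAddDeriv, ih hψ, ih hψ.deriv]

theorem exists_abs_prodOneAddDeriv_le (n : ℕ) {ψ : ℝ → ℝ} (hψ : IsAnnulusCutoff ψ) :
    ∃ B, 0 ≤ B ∧ ∀ a : Fin n → ℝ, (∀ i, |a i| ≤ 1) → ∀ s, |prodOneAddDeriv n a ψ s| ≤ B := by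
  induction n generalizing ψ with
  | zero =>
    obtain ⟨B, hB0, hB⟩ := hψ.exists_abs_le
    exact ⟨B, hB0, fun _ _ => hB⟩
  | succ n ih =>
    obtain ⟨B, hB0, hB⟩ := ih hψ
    obtain ⟨B', hB0', hB'⟩ := ih hψ.deriv
    refine ⟨B + B', by positivity, fun a ha s => (abs_add_le _ _).trans (add_le_add ?_ ?_)⟩
    · exact hB _ (fun i => ha i.succ) s
    · rw [abs_mul]
      calc _ ≤ 1 * B' := mul_le_mul (ha 0) (hB' _ (fun i => ha i.succ) s) (abs_nonneg _) zero_le_one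
        _ = B' := one_mul _

theorem integrable_prod_expKernel (n : ℕ) :
    Integrable fun r : Fin n → ℝ => ∏ i, expKernel (r i) :=
  Integrable.fintype_prod fun _ => integrable_expKernel

theorem measurable_prod_expKernel (n : ℕ) :
    Measurable fun r : Fin n → ℝ => ∏ i, expKernel (r i) :=
  Finset.measurable_prod _ fun i _ => measurable_expKernel.comp (measurable_pi_apply i)

theorem prod_expKernel_nonneg {n : ℕ} (r : Fin n → ℝ) : 0 ≤ ∏ i, expKernel (r i) :=
  Finset.prod_nonneg fun _ _ => expKernel_nonneg _

theorem integral_prod_expKernel (n : ℕ) :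
    ∫ r : Fin n → ℝ, ∏ i, expKernel (r i) = 1 := by
  rw [integral_fintype_prod_volume_eq_prod]
  simp [integral_expKernel]

theorem norm_toLp_le_sum {n : ℕ} (r : Fin n → ℝ) : ‖WithLp.toLp 2 r‖ ≤ ∑ i, |r i| := by
  rw [EuclideanSpace.norm_eq]
  refine Real.sqrt_le_iff.2 ⟨Finset.sum_nonneg fun _ _ => abs_nonneg _, ?_⟩
  exact Finset.sum_sq_le_sq_sum_of_nonneg fun _ _ => abs_nonneg _

/-- On the positive orthant the product is $e^{-\|r\|_1}$, and $\|r\|_2\le\|r\|_1$; elsewhere it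
vanishes. -/
theorem prod_expKernel_le {n : ℕ} (r : Fin n → ℝ) :
    ∏ i, expKernel (r i) ≤ Real.exp (-‖WithLp.toLp 2 r‖) := by
  by_cases h : ∀ i, 0 < r i
  · have h1 : ∀ i, expKernel (r i) = Real.exp (-|r i|) := fun i => by
      rw [expKernel, Set.indicator_of_mem (Set.mem_Ioi.2 (h i)), abs_of_pos (h i)]
    simp only [h1]
    rw [← Real.exp_sum, Finset.sum_neg_distrib]
    exact Real.exp_le_exp.2 (neg_le_neg (norm_toLp_le_sum r))
  · push Not at h
    obtain ⟨i, hi⟩ := h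
    rw [Finset.prod_eq_zero (Finset.mem_univ i)
      (Set.indicator_of_notMem (Set.notMem_Ioi.2 hi) _)]
    positivity

theorem integrable_prod_expKernel_mul_prodOneAddDeriv (n : ℕ) {ψ : ℝ → ℝ}
    (hψ : IsAnnulusCutoff ψ) {a : Fin n → ℝ} (ha : ∀ i, |a i| ≤ 1) (s : ℝ) :
    Integrable fun r : Fin n → ℝ =>
      (∏ i, expKernel (r i)) * prodOneAddDeriv n a ψ (s - ∑ i, a i * r i) := by
  obtain ⟨B, -, hB⟩ := exists_abs_prodOneAddDeriv_le n hψ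
  have hc : Continuous fun r : Fin n → ℝ => prodOneAddDeriv n a ψ (s - ∑ i, a i * r i) :=
    (continuous_prodOneAddDeriv n hψ).comp
      (by fun_prop : Continuous fun r : Fin n → ℝ => (a, s - ∑ i, a i * r i))
  exact (integrable_prod_expKernel n).mul_bdd (c := B) hc.aestronglyMeasurable
    (.of_forall fun r => hB a ha _)

/-- The function `ψ` is recovered from `∏ i, (1 + a i ∂) ψ` by averaging. -/
theorem integral_prod_expKernel_mul (n : ℕ) {ψ : ℝ → ℝ} (hψ : IsAnnulusCutoff ψ)
    {a : Fin n → ℝ} (ha : ∀ i, |a i| ≤ 1) (s : ℝ) :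
    ∫ r : Fin n → ℝ, (∏ i, expKernel (r i)) * prodOneAddDeriv n a ψ (s - ∑ i, a i * r i) =
      ψ s := by
  induction n generalizing ψ s with
  | zero => simp [prodOneAddDeriv, integral_unique, Measure.real, volume_pi]
  | succ n ih =>
    have ha' : ∀ i, |Fin.tail a i| ≤ 1 := fun i => ha i.succ
    have hmp := (volume_preserving_piFinSuccAbove (fun _ : Fin (n + 1) => ℝ) 0).symm
    have hemb := (MeasurableEquiv.piFinSuccAbove (fun _ : Fin (n + 1) => ℝ) 0).symm.measurableEmbedding
    have hcons : ∀ p : ℝ × (Fin n → ℝ),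
        (MeasurableEquiv.piFinSuccAbove (fun _ : Fin (n + 1) => ℝ) 0).symm p = Fin.cons p.1 p.2 :=
      fun p => Fin.insertNth_zero' p.1 p.2
    have hint := (hmp.integrable_comp_emb hemb).2
      (integrable_prod_expKernel_mul_prodOneAddDeriv (n + 1) hψ ha s)
    rw [← hmp.integral_comp hemb]
    simp only [Function.comp_def, hcons] at hint ⊢
    rw [Measure.volume_eq_prod, integral_prod _ hint]
    -- After Fubini the inner integral is evaluated by induction for both $\psi$ and $\psi'$ at
    -- $s-a_0t$, leaving the one-variable identity in $t$.
    refine Eq.trans (integral_congr_ae (.of_forall fun t => ?_))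
      (integral_expKernel_mul_add_deriv hψ (a 0) s)
    have e1 := ih hψ ha' (s - a 0 * t)
    have e2 := ih hψ.deriv ha' (s - a 0 * t)
    have i1 := integrable_prod_expKernel_mul_prodOneAddDeriv n hψ ha' (s - a 0 * t)
    have i2 := integrable_prod_expKernel_mul_prodOneAddDeriv n hψ.deriv ha' (s - a 0 * t)
    rw [← e1, ← e2, ← integral_const_mul, ← integral_add i1 (i2.const_mul _),
      ← integral_const_mul]
    refine integral_congr_ae (.of_forall fun r => ?_)
    simp only [Fin.prod_univ_succ, Fin.sum_univ_succ, Fin.cons_zero, Fin.cons_succ,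
      prodOneAddDeriv, Fin.tail, ← sub_sub]
    ring

/-- The Cauchy–Schwarz inequality with a weight. -/
theorem sq_lintegral_mul_le {α : Type*} [MeasurableSpace α] {μ : Measure α} {p H : α → ℝ≥0∞}
    (hp : AEMeasurable p μ) (hH : AEMeasurable H μ) :
    (∫⁻ x, p x * H x ∂μ) ^ 2 ≤ (∫⁻ x, p x ∂μ) * ∫⁻ x, p x * H x ^ 2 ∂μ := by
  have hsq : ∀ y : ℝ≥0∞, (y ^ (1 / 2 : ℝ)) ^ 2 = y := fun y => by
    rw [← ENNReal.rpow_natCast, ← ENNReal.rpow_mul]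
    norm_num
  have hmul : ∀ y : ℝ≥0∞, y ^ (1 / 2 : ℝ) * y ^ (1 / 2 : ℝ) = y := fun y => by
    rw [← sq, hsq]
  have h := ENNReal.lintegral_mul_le_Lp_mul_Lq μ Real.HolderConjugate.two_two
    (hp.pow_const (1 / 2 : ℝ)) ((hp.pow_const (1 / 2 : ℝ)).mul hH)
  simp only [Pi.mul_apply, ← mul_assoc, hmul, ENNReal.rpow_ofNat, mul_pow, hsq] at h
  calc _ ≤ _ := pow_le_pow_left₀ zero_le h 2
    _ = _ := by rw [mul_pow, hsq, hsq]

/-! ### Averaged symbols and the maximal estimate over a sphere of radius $R$. -/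

section

variable {n : ℕ} {ψ : ℝ → ℝ}

/-- The symbol `∏ i, (1 + ∂ / ∂ wᵢ) ψ (⟨w, ξ / |ξ|⟩)`. -/
noncomputable def averagedSymbol (ψ : ℝ → ℝ) (w ξ : EuclideanSpace ℝ (Fin n)) : ℝ :=
  prodOneAddDeriv n (fun i => (‖ξ‖⁻¹ • ξ) i) ψ (inner ℝ w (‖ξ‖⁻¹ • ξ))

theorem norm_inv_norm_smul_le (ξ : EuclideanSpace ℝ (Fin n)) : ‖‖ξ‖⁻¹ • ξ‖ ≤ 1 := by
  rw [norm_smul, norm_inv, norm_norm]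
  exact inv_mul_le_one

theorem abs_inv_norm_smul_apply_le (ξ : EuclideanSpace ℝ (Fin n)) (i : Fin n) :
    |(‖ξ‖⁻¹ • ξ) i| ≤ 1 :=
  (PiLp.norm_apply_le (‖ξ‖⁻¹ • ξ) i).trans (norm_inv_norm_smul_le ξ)

theorem measurable_inv_norm_smul :
    Measurable fun ξ : EuclideanSpace ℝ (Fin n) => ‖ξ‖⁻¹ • ξ :=
  measurable_norm.inv.smul measurable_id

theorem measurable_averagedSymbol (hψ : IsAnnulusCutoff ψ) {α : Type*} [MeasurableSpace α]
    {a b : α → EuclideanSpace ℝ (Fin n)} (ha : Measurable a) (hb : Measurable b) :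
    Measurable fun q => averagedSymbol ψ (a q) (b q) := by
  have hd : Measurable fun q => ‖b q‖⁻¹ • b q := measurable_inv_norm_smul.comp hb
  refine (continuous_prodOneAddDeriv n hψ).measurable.comp (Measurable.prodMk ?_ ?_)
  · exact (WithLp.measurable_ofLp 2 (Fin n → ℝ)).comp hd
  · exact ha.inner hd

theorem exists_abs_averagedSymbol_le (n : ℕ) (hψ : IsAnnulusCutoff ψ) :
    ∃ B, 0 ≤ B ∧ ∀ w ξ : EuclideanSpace ℝ (Fin n), |averagedSymbol ψ w ξ| ≤ B := by
  obtain ⟨B, hB0, hB⟩ := exists_abs_prodOneAddDeriv_le n hψ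
  exact ⟨B, hB0, fun w ξ => hB _ (abs_inv_norm_smul_apply_le ξ) _⟩

theorem averagedSymbol_eq_zero (hψ : IsAnnulusCutoff ψ) {w ξ : EuclideanSpace ℝ (Fin n)}
    (h : 2 < |inner ℝ w (‖ξ‖⁻¹ • ξ)|) : averagedSymbol ψ w ξ = 0 :=
  prodOneAddDeriv_eq_zero n hψ _ h

theorem inner_sub_toLp (v θ : EuclideanSpace ℝ (Fin n)) (r : Fin n → ℝ) :
    inner ℝ (v - WithLp.toLp 2 r) θ = inner ℝ v θ - ∑ i, θ i * r i := by
  rw [inner_sub_left]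
  simp [PiLp.inner_apply]

theorem integral_prod_expKernel_mul_averagedSymbol (hψ : IsAnnulusCutoff ψ)
    (v ξ : EuclideanSpace ℝ (Fin n)) :
    ∫ r : Fin n → ℝ, (∏ i, expKernel (r i)) * averagedSymbol ψ (v - WithLp.toLp 2 r) ξ =
      ψ (inner ℝ v (‖ξ‖⁻¹ • ξ)) := by
  simp only [averagedSymbol, inner_sub_toLp]
  exact integral_prod_expKernel_mul n hψ (abs_inv_norm_smul_apply_le ξ) _

variable {g : EuclideanSpace ℝ (Fin n) → ℂ}

theorem measurable_cexp_inner {α : Type*} [MeasurableSpace α]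
    {a b : α → EuclideanSpace ℝ (Fin n)} (ha : Measurable a) (hb : Measurable b) :
    Measurable fun q =>
      Complex.exp (((2 * Real.pi * inner ℝ (a q) (b q) : ℝ) : ℂ) * Complex.I) :=
  Complex.measurable_exp.comp ((Complex.measurable_ofReal.comp
    ((ha.inner hb).const_mul (2 * Real.pi))).mul_const Complex.I)

theorem measurable_fourierInv_averagedSymbol_mul (hψ : IsAnnulusCutoff ψ) (hg : Measurable g) :
    Measurable fun p : EuclideanSpace ℝ (Fin n) × EuclideanSpace ℝ (Fin n) =>
      𝓕⁻ (fun ξ => (averagedSymbol ψ p.1 ξ : ℂ) * g ξ) p.2 := by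
  simp only [Real.fourierInv_eq']
  refine (StronglyMeasurable.integral_prod_right
    (f := fun (p : EuclideanSpace ℝ (Fin n) × EuclideanSpace ℝ (Fin n))
      (ξ : EuclideanSpace ℝ (Fin n)) =>
      Complex.exp (((2 * Real.pi * inner ℝ ξ p.2 : ℝ) : ℂ) * Complex.I) •
        ((averagedSymbol ψ p.1 ξ : ℂ) * g ξ)) ?_).measurable
  have h1 : Measurable fun q : (EuclideanSpace ℝ (Fin n) × EuclideanSpace ℝ (Fin n)) ×
      EuclideanSpace ℝ (Fin n) => q.1.1 := measurable_fst.comp measurable_fst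
  have h2 : Measurable fun q : (EuclideanSpace ℝ (Fin n) × EuclideanSpace ℝ (Fin n)) ×
      EuclideanSpace ℝ (Fin n) => q.1.2 := measurable_snd.comp measurable_fst
  have hA := measurable_averagedSymbol hψ h1 measurable_snd
  have hE := measurable_cexp_inner measurable_snd h2
  exact (hE.smul ((Complex.measurable_ofReal.comp hA).mul
    (hg.comp measurable_snd))).stronglyMeasurable

theorem integrable_averagedSymbol_mul_expKernel (hψ : IsAnnulusCutoff ψ) (hg : Integrable g)
    (v x : EuclideanSpace ℝ (Fin n)) :
    Integrable (Function.uncurry fun (ξ : EuclideanSpace ℝ (Fin n)) (r : Fin n → ℝ) =>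
      (Complex.exp (((2 * Real.pi * inner ℝ ξ x : ℝ) : ℂ) * Complex.I) *
        (averagedSymbol ψ (v - WithLp.toLp 2 r) ξ : ℂ)) *
          (g ξ * ((∏ i, expKernel (r i) : ℝ) : ℂ))) := by
  obtain ⟨B, -, hB⟩ := exists_abs_averagedSymbol_le n hψ
  have h1 : Measurable fun p : EuclideanSpace ℝ (Fin n) × (Fin n → ℝ) =>
      v - WithLp.toLp 2 p.2 := by fun_prop
  have hm := measurable_averagedSymbol hψ h1 measurable_fst
  have hE := measurable_cexp_inner (measurable_fst (α := EuclideanSpace ℝ (Fin n))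
    (β := Fin n → ℝ)) (measurable_const (a := x))
  have hK : Integrable fun r : Fin n → ℝ => ((∏ i, expKernel (r i) : ℝ) : ℂ) :=
    (integrable_prod_expKernel n).ofReal
  refine (hg.mul_prod hK).bdd_mul (c := B)
    (hE.mul (Complex.measurable_ofReal.comp hm)).aestronglyMeasurable (.of_forall fun p => ?_)
  rw [norm_mul, Complex.norm_exp_ofReal_mul_I, one_mul, Complex.norm_real]
  exact hB _ _

theorem fourierInv_mul_eq_integral_expKernel (hψ : IsAnnulusCutoff ψ) (hg : Integrable g)
    (v x : EuclideanSpace ℝ (Fin n)) :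
    𝓕⁻ (fun ξ => (ψ (inner ℝ v (‖ξ‖⁻¹ • ξ)) : ℂ) * g ξ) x =
      ∫ r : Fin n → ℝ, ((∏ i, expKernel (r i) : ℝ) : ℂ) *
        𝓕⁻ (fun ξ => (averagedSymbol ψ (v - WithLp.toLp 2 r) ξ : ℂ) * g ξ) x := by
  rw [Real.fourierInv_eq']
  calc _ = ∫ ξ, ∫ r : Fin n → ℝ,
        (Complex.exp (((2 * Real.pi * inner ℝ ξ x : ℝ) : ℂ) * Complex.I) *
        (averagedSymbol ψ (v - WithLp.toLp 2 r) ξ : ℂ)) *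
          (g ξ * ((∏ i, expKernel (r i) : ℝ) : ℂ)) := by
        refine integral_congr_ae (.of_forall fun ξ => ?_)
        simp only [smul_eq_mul]
        rw [← integral_prod_expKernel_mul_averagedSymbol hψ v ξ, ← integral_complex_ofReal,
          ← integral_mul_const, ← integral_const_mul]
        refine integral_congr_ae (.of_forall fun r => ?_)
        simp only [Complex.ofReal_mul]
        ring
    _ = _ := by
        rw [integral_integral_swap (integrable_averagedSymbol_mul_expKernel hψ hg v x)]
        refine integral_congr_ae (.of_forall fun r => ?_)
        simp only [Real.fourierInv_eq', ← integral_const_mul]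
        refine integral_congr_ae (.of_forall fun ξ => ?_)
        simp only [smul_eq_mul]
        ring

/-- The heart of the matter: Cauchy–Schwarz against a probability density, then two enlargements of
that density until only $\|v\|$ is visible, so that one majorant serves all directions. -/
theorem enorm_fourierInv_mul_sq_le (hψ : IsAnnulusCutoff ψ) (hgm : Measurable g)
    (hg : Integrable g) (v x : EuclideanSpace ℝ (Fin n)) :
    ‖𝓕⁻ (fun ξ => (ψ (inner ℝ v (‖ξ‖⁻¹ • ξ)) : ℂ) * g ξ) x‖ₑ ^ 2 ≤
      ∫⁻ w, ENNReal.ofReal (Real.exp (-|‖w‖ - ‖v‖|)) *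
        ‖𝓕⁻ (fun ξ => (averagedSymbol ψ w ξ : ℂ) * g ξ) x‖ₑ ^ 2 := by
  set F : EuclideanSpace ℝ (Fin n) → ℝ≥0∞ := fun w =>
    ‖𝓕⁻ (fun ξ => (averagedSymbol ψ w ξ : ℂ) * g ξ) x‖ₑ with hF
  have hFm : Measurable F :=
    ((measurable_fourierInv_averagedSymbol_mul hψ hgm).comp
      (measurable_id.prodMk measurable_const)).enorm
  have hp : ∫⁻ r : Fin n → ℝ, ENNReal.ofReal (∏ i, expKernel (r i)) = 1 := by
    rw [← ofReal_integral_eq_lintegral_ofReal (integrable_prod_expKernel n)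
      (.of_forall prod_expKernel_nonneg), integral_prod_expKernel, ENNReal.ofReal_one]
  rw [fourierInv_mul_eq_integral_expKernel hψ hg]
  calc _ ≤ (∫⁻ r : Fin n → ℝ, ENNReal.ofReal (∏ i, expKernel (r i)) *
        F (v - WithLp.toLp 2 r)) ^ 2 := by
        gcongr
        refine (enorm_integral_le_lintegral_enorm _).trans_eq (lintegral_congr fun r => ?_)
        rw [enorm_mul, ← ofReal_norm, Complex.norm_real,
          Real.norm_of_nonneg (prod_expKernel_nonneg r)]
    _ ≤ ∫⁻ r : Fin n → ℝ, ENNReal.ofReal (∏ i, expKernel (r i)) *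
        F (v - WithLp.toLp 2 r) ^ 2 := by
        refine (sq_lintegral_mul_le (measurable_prod_expKernel n).ennreal_ofReal.aemeasurable
          (hFm.comp (by fun_prop)).aemeasurable).trans_eq ?_
        rw [hp, one_mul]
        rfl
    _ ≤ ∫⁻ r : Fin n → ℝ, ENNReal.ofReal (Real.exp (-‖WithLp.toLp 2 r‖)) *
        F (v - WithLp.toLp 2 r) ^ 2 := by
        gcongr with r
        exact prod_expKernel_le r
    _ = ∫⁻ ρ : EuclideanSpace ℝ (Fin n), ENNReal.ofReal (Real.exp (-‖ρ‖)) * F (v - ρ) ^ 2 :=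
        (PiLp.volume_preserving_toLp (Fin n)).lintegral_comp_emb
          (MeasurableEquiv.toLp 2 _).measurableEmbedding
          (fun ρ => ENNReal.ofReal (Real.exp (-‖ρ‖)) * F (v - ρ) ^ 2)
    _ = ∫⁻ w, ENNReal.ofReal (Real.exp (-‖v - w‖)) * F w ^ 2 := by
        rw [← lintegral_sub_left_eq_self _ v]
        simp only [sub_sub_cancel]
    _ ≤ _ := by
        gcongr with w
        rw [abs_sub_comm]
        exact abs_norm_sub_norm_le v w

/-- The `L²` maximal estimate for the symbols `ψ (⟨v, ξ / |ξ|⟩)` over a sphere `|v| = R`. -/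
theorem exists_lintegral_iSup_fourierInv_sq_le (hn : 2 ≤ n) (hψ : IsAnnulusCutoff ψ) :
    ∃ C : ℝ, 0 < C ∧ ∀ R : ℝ, 1 / 2 ≤ R → ∀ g : EuclideanSpace ℝ (Fin n) → ℂ, Measurable g →
      Integrable g → MemLp g 2 → ∃ H : EuclideanSpace ℝ (Fin n) → ℝ≥0∞,
        (∀ v, ‖v‖ = R → ∀ x,
          ‖𝓕⁻ (fun ξ => (ψ (inner ℝ v (‖ξ‖⁻¹ • ξ)) : ℂ) * g ξ) x‖ₑ ^ 2 ≤ H x) ∧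
        ∫⁻ x, H x ≤ ENNReal.ofReal (C * R ^ (n - 2)) * ∫⁻ ξ, ‖g ξ‖ₑ ^ 2 := by
  obtain ⟨B, hB0, hB⟩ := exists_abs_averagedSymbol_le n hψ
  obtain ⟨C, hC0, hC⟩ := exists_lintegral_slab_le hn
  refine ⟨(B ^ 2 + 1) * C, by positivity, fun R hR g hgm hg hg2 => ?_⟩
  refine ⟨fun x => ∫⁻ w, ENNReal.ofReal (Real.exp (-|‖w‖ - R|)) *
        ‖𝓕⁻ (fun ξ => (averagedSymbol ψ w ξ : ℂ) * g ξ) x‖ₑ ^ 2, ?_, ?_⟩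
  · rintro v rfl x
    exact enorm_fourierInv_mul_sq_le hψ hgm hg v x
  have hFm := measurable_fourierInv_averagedSymbol_mul hψ hgm
  have : Nonempty (Fin n) := ⟨⟨0, by omega⟩⟩
  have hPl : ∀ w, ∫⁻ x, ‖𝓕⁻ (fun ξ => (averagedSymbol ψ w ξ : ℂ) * g ξ) x‖ₑ ^ 2 =
      ∫⁻ ξ, ‖(averagedSymbol ψ w ξ : ℂ) * g ξ‖ₑ ^ 2 := fun w => by
    have hAw : AEStronglyMeasurable (fun ξ => (averagedSymbol ψ w ξ : ℂ)) volume :=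
      (Complex.measurable_ofReal.comp
        (measurable_averagedSymbol hψ measurable_const measurable_id)).aestronglyMeasurable
    have hAb : ∀ᵐ ξ, ‖(averagedSymbol ψ w ξ : ℂ)‖ ≤ B := .of_forall fun ξ => by
      rw [Complex.norm_real]
      exact hB w ξ
    exact lintegral_enorm_fourierInv_sq (hg.bdd_mul hAw hAb)
      (hg2.of_le_mul (hAw.mul hg.aestronglyMeasurable) (hAb.mono fun ξ hξ => by
        rw [norm_mul]
        gcongr))
  have hW : Measurable fun w : EuclideanSpace ℝ (Fin n) =>
      ENNReal.ofReal (Real.exp (-|‖w‖ - R|)) := by fun_prop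
  calc _ = ∫⁻ w, ENNReal.ofReal (Real.exp (-|‖w‖ - R|)) *
        ∫⁻ x, ‖𝓕⁻ (fun ξ => (averagedSymbol ψ w ξ : ℂ) * g ξ) x‖ₑ ^ 2 := by
        rw [lintegral_lintegral_swap]
        · refine lintegral_congr fun w => lintegral_const_mul _ ?_
          exact (hFm.comp (measurable_const.prodMk measurable_id)).enorm.pow_const 2
        · exact ((hW.comp measurable_snd).mul
            ((hFm.comp measurable_swap).enorm.pow_const 2)).aemeasurable
    _ = ∫⁻ w, ∫⁻ ξ, ENNReal.ofReal (Real.exp (-|‖w‖ - R|)) *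
        ‖(averagedSymbol ψ w ξ : ℂ) * g ξ‖ₑ ^ 2 := by
        refine lintegral_congr fun w => ?_
        rw [hPl, lintegral_const_mul]
        exact ((Complex.measurable_ofReal.comp
          (measurable_averagedSymbol hψ measurable_const measurable_id)).mul hgm).enorm.pow_const 2
    _ = ∫⁻ ξ, ∫⁻ w, ENNReal.ofReal (Real.exp (-|‖w‖ - R|)) *
        ‖(averagedSymbol ψ w ξ : ℂ) * g ξ‖ₑ ^ 2 := by
        exact lintegral_lintegral_swap ((hW.comp measurable_fst).mul
          (((Complex.measurable_ofReal.comp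
            (measurable_averagedSymbol hψ measurable_fst measurable_snd)).mul
            (hgm.comp measurable_snd)).enorm.pow_const 2)).aemeasurable
    _ ≤ ∫⁻ ξ, ENNReal.ofReal ((B ^ 2 + 1) * C * R ^ (n - 2)) * ‖g ξ‖ₑ ^ 2 := by
        refine lintegral_mono_ae ?_
        -- At $\xi=0$ the direction $\|\xi\|^{-1}\xi$ is $0$, and the slab bound needs a unit
        -- normal.
        filter_upwards [Measure.ae_ne volume (0 : EuclideanSpace ℝ (Fin n))] with ξ hξ
        set θ := ‖ξ‖⁻¹ • ξ with hθ
        have hθ1 : ‖θ‖ = 1 := by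
          rw [hθ, norm_smul, norm_inv, norm_norm, inv_mul_cancel₀ (norm_ne_zero_iff.2 hξ)]
        have hS : MeasurableSet {w : EuclideanSpace ℝ (Fin n) | |inner ℝ w θ| ≤ 2} :=
          measurableSet_le (by fun_prop) (by fun_prop)
        calc _ ≤ ∫⁻ w, {w : EuclideanSpace ℝ (Fin n) | |inner ℝ w θ| ≤ 2}.indicator
              (fun w => ENNReal.ofReal (Real.exp (-|‖w‖ - R|))) w *
                (ENNReal.ofReal (B ^ 2 + 1) * ‖g ξ‖ₑ ^ 2) := by
              refine lintegral_mono fun w => ?_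
              by_cases hw : |inner ℝ w θ| ≤ 2
              · rw [Set.indicator_of_mem (Set.mem_ofPred_eq ▸ hw)]
                gcongr
                rw [enorm_mul, mul_pow]
                gcongr
                rw [← ofReal_norm, Complex.norm_real,
                  ← ENNReal.ofReal_pow (norm_nonneg _)]
                refine ENNReal.ofReal_le_ofReal ?_
                have := pow_le_pow_left₀ (abs_nonneg _) (hB w ξ) 2
                rw [Real.norm_eq_abs]
                exact this.trans (by linarith)
              · rw [averagedSymbol_eq_zero hψ (not_le.1 hw)]
                simp
          _ ≤ _ := by
              rw [lintegral_mul_const _ (Measurable.indicator (by fun_prop) hS),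
                lintegral_indicator hS, ← mul_assoc]
              gcongr
              refine (mul_le_mul_left (hC R hR θ hθ1) _).trans_eq ?_
              rw [← ENNReal.ofReal_mul (by positivity)]
              congr 1
              ring
    _ = _ := lintegral_const_mul _ (hgm.enorm.pow_const 2)

end

/-! ### The thin big circle operator. -/

section

variable {n : ℕ} {φ : EuclideanSpace ℝ (Fin n) → ℝ}

theorem localizedMultiplier_eq_fourierInv (σ : EuclideanSpace ℝ (Fin n) → ℝ)
    (f : Lp ℂ 2 (volume : Measure (EuclideanSpace ℝ (Fin n)))) :
    localizedMultiplier φ σ f = 𝓕⁻ (fun ξ => (σ ξ : ℂ) * ((φ ξ : ℂ) * (𝓕 f) ξ)) := by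
  ext x
  rw [Real.fourierInv_eq']
  refine integral_congr_ae (.of_forall fun ξ => ?_)
  simp only [smul_eq_mul]
  rw [mul_comm, mul_assoc (σ ξ : ℂ)]
  congr 2
  push_cast
  ring

theorem measurable_cutoff_mul_fourier (hφ : IsAnnulusCutoff φ)
    (f : Lp ℂ 2 (volume : Measure (EuclideanSpace ℝ (Fin n)))) :
    Measurable fun ξ => (φ ξ : ℂ) * (𝓕 f) ξ :=
  (Complex.measurable_ofReal.comp hφ.contDiff.continuous.measurable).mul
    (Lp.stronglyMeasurable _).measurable

theorem memLp_ofReal_cutoff (hφ : IsAnnulusCutoff φ) :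
    MemLp (fun ξ => (φ ξ : ℂ)) 2 volume :=
  (hφ.contDiff.continuous.memLp_of_hasCompactSupport hφ.hasCompactSupport).ofReal

/-- A product of two $L^2$ functions, so the multiplier integrals converge absolutely at every $x$.
-/
theorem integrable_cutoff_mul_fourier (hφ : IsAnnulusCutoff φ)
    (f : Lp ℂ 2 (volume : Measure (EuclideanSpace ℝ (Fin n)))) :
    Integrable fun ξ => (φ ξ : ℂ) * (𝓕 f) ξ :=
  (memLp_ofReal_cutoff hφ).integrable_mul (Lp.memLp _)

theorem memLp_cutoff_mul_fourier (hφ : IsAnnulusCutoff φ)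
    (f : Lp ℂ 2 (volume : Measure (EuclideanSpace ℝ (Fin n)))) :
    MemLp (fun ξ => (φ ξ : ℂ) * (𝓕 f) ξ) 2 := by
  obtain ⟨B, -, hB⟩ := hφ.exists_abs_le
  refine (Lp.memLp (𝓕 f)).of_le_mul (c := B)
    (measurable_cutoff_mul_fourier hφ f).aestronglyMeasurable (.of_forall fun ξ => ?_)
  rw [norm_mul, Complex.norm_real]
  gcongr
  exact hB ξ

theorem lintegral_enorm_fourier_sq (f : Lp ℂ 2 (volume : Measure (EuclideanSpace ℝ (Fin n)))) :
    ∫⁻ ξ, ‖(𝓕 f) ξ‖ₑ ^ 2 = ENNReal.ofReal ‖f‖ ^ 2 := by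
  have e := eLpNorm_nnreal_pow_eq_lintegral (f := (𝓕 f : Lp ℂ 2 volume)) (μ := volume) (p := 2)
    two_ne_zero
  simp only [NNReal.coe_ofNat, ENNReal.coe_ofNat, ENNReal.rpow_ofNat] at e
  rw [← e, ← Lp.enorm_def, ← ofReal_norm, Lp.norm_fourier_eq]

theorem lintegral_cutoff_mul_fourier_sq_le {B : ℝ} (hB : ∀ ξ, |φ ξ| ≤ B)
    (f : Lp ℂ 2 (volume : Measure (EuclideanSpace ℝ (Fin n)))) :
    ∫⁻ ξ, ‖(φ ξ : ℂ) * (𝓕 f) ξ‖ₑ ^ 2 ≤ ENNReal.ofReal (B * ‖f‖) ^ 2 := by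
  have hB0 : 0 ≤ B := (abs_nonneg _).trans (hB 0)
  rw [ENNReal.ofReal_mul hB0, mul_pow, ← lintegral_enorm_fourier_sq, ← lintegral_const_mul]
  · refine lintegral_mono fun ξ => ?_
    rw [enorm_mul, mul_pow, ← ofReal_norm (φ ξ : ℂ), Complex.norm_real]
    gcongr
    exact hB ξ
  · exact (Lp.stronglyMeasurable _).measurable.enorm.pow_const 2

theorem integrable_symbol_mul (hφ : IsAnnulusCutoff φ) {σ : EuclideanSpace ℝ (Fin n) → ℝ}
    (hσ : Measurable σ) {B : ℝ} (hB : ∀ ξ, |σ ξ| ≤ B)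
    (f : Lp ℂ 2 (volume : Measure (EuclideanSpace ℝ (Fin n)))) :
    Integrable fun ξ => (σ ξ : ℂ) * ((φ ξ : ℂ) * (𝓕 f) ξ) :=
  (integrable_cutoff_mul_fourier hφ f).bdd_mul (c := B)
    (Complex.measurable_ofReal.comp hσ).aestronglyMeasurable
    (.of_forall fun ξ => (Complex.norm_real _).trans_le (hB ξ))

theorem continuous_localizedMultiplier (hφ : IsAnnulusCutoff φ)
    {σ : EuclideanSpace ℝ (Fin n) → ℝ} (hσ : Measurable σ) {B : ℝ} (hB : ∀ ξ, |σ ξ| ≤ B)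
    (f : Lp ℂ 2 (volume : Measure (EuclideanSpace ℝ (Fin n)))) :
    Continuous (localizedMultiplier φ σ f) := by
  rw [localizedMultiplier_eq_fourierInv]
  exact VectorFourier.fourierIntegral_continuous (L := -innerₗ _) Real.continuous_fourierChar
    (by simp only [LinearMap.neg_apply, innerₗ_apply_apply]; fun_prop)
    (integrable_symbol_mul hφ hσ hB f)

/-- The supremum may be uncountable, but a supremum of continuous functions is lower semicontinuous.
-/
theorem measurable_iSup_localizedMultiplier (hφ : IsAnnulusCutoff φ) {ι : Type*}
    {σ : ι → EuclideanSpace ℝ (Fin n) → ℝ} (hσ : ∀ i, Measurable (σ i)) {B : ℝ}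
    (hB : ∀ i ξ, |σ i ξ| ≤ B) (f : Lp ℂ 2 (volume : Measure (EuclideanSpace ℝ (Fin n)))) :
    Measurable fun x => ⨆ i, ‖localizedMultiplier φ (σ i) f x‖ₑ :=
  (lowerSemicontinuous_iSup fun i =>
    (continuous_localizedMultiplier hφ (hσ i) (hB i) f).enorm.lowerSemicontinuous).measurable

theorem measurable_inner_inv_norm_smul (u : EuclideanSpace ℝ (Fin n)) :
    Measurable fun ξ : EuclideanSpace ℝ (Fin n) => inner ℝ u (‖ξ‖⁻¹ • ξ) :=
  measurable_const.inner measurable_inv_norm_smul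

theorem abs_inner_inv_norm_smul_le {u : EuclideanSpace ℝ (Fin n)} (hu : ‖u‖ = 1)
    (ξ : EuclideanSpace ℝ (Fin n)) : |inner ℝ u (‖ξ‖⁻¹ • ξ)| ≤ 1 := by
  refine (abs_real_inner_le_norm _ _).trans ?_
  rw [hu, one_mul]
  exact norm_inv_norm_smul_le ξ

theorem measurable_thinBigCircleMax (hφ : IsAnnulusCutoff φ) {ψ : ℝ → ℝ}
    (hψ : IsAnnulusCutoff ψ) (m : ℤ)
    (f : Lp ℂ 2 (volume : Measure (EuclideanSpace ℝ (Fin n)))) :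
    Measurable (thinBigCircleMax ψ φ m f) := by
  obtain ⟨B, -, hB⟩ := hψ.exists_abs_le
  exact measurable_iSup_localizedMultiplier hφ
    (fun u : Metric.sphere (0 : EuclideanSpace ℝ (Fin n)) 1 =>
      hψ.contDiff.continuous.measurable.comp
        ((measurable_inner_inv_norm_smul (u : EuclideanSpace ℝ (Fin n))).const_mul _))
    (fun _ _ => hB _) f

/-- Here $|2^m\langle u,\xi/|\xi|\rangle|\le1/4$, below the support of $\psi$. Only $R=2^m\ge1/2$ is
left to treat. -/
theorem thinBigCircleMax_eq_zero {ψ : ℝ → ℝ} (hψ : IsAnnulusCutoff ψ) {m : ℤ} (hm : m < -1)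
    (f : Lp ℂ 2 (volume : Measure (EuclideanSpace ℝ (Fin n)))) (x : EuclideanSpace ℝ (Fin n)) :
    thinBigCircleMax ψ φ m f x = 0 := by
  refine ENNReal.iSup_eq_zero.2 fun u => ?_
  have h : ∀ ξ : EuclideanSpace ℝ (Fin n),
      ψ ((2 : ℝ) ^ m * inner ℝ (u : EuclideanSpace ℝ (Fin n)) (‖ξ‖⁻¹ • ξ)) = 0 := fun ξ => by
    by_contra hne
    have h1 : 1 / 2 ≤ |(2 : ℝ) ^ m * inner ℝ (u : EuclideanSpace ℝ (Fin n)) (‖ξ‖⁻¹ • ξ)| :=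
      (hψ.support_subset hne).1
    have h2 : (2 : ℝ) ^ m ≤ 2 ^ (-2 : ℤ) := zpow_le_zpow_right₀ one_le_two (by omega)
    have h3 := abs_inner_inv_norm_smul_le (mem_sphere_zero_iff_norm.1 u.2) ξ
    rw [abs_mul, abs_of_pos (zpow_pos two_pos m)] at h1
    have h4 := mul_le_mul h2 h3 (abs_nonneg _) (by positivity)
    norm_num at h1 h4
    linarith
  simp [localizedMultiplier, h]

/-- The `L²` bound for the maximal thin big circle operator. -/
theorem exists_lintegral_thinBigCircleMax_sq_le (hn : 2 ≤ n) (hφ : IsAnnulusCutoff φ)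
    {ψ : ℝ → ℝ} (hψ : IsAnnulusCutoff ψ) :
    ∃ C : ℝ, 0 < C ∧ ∀ (m : ℤ) (f : Lp ℂ 2 (volume : Measure (EuclideanSpace ℝ (Fin n)))),
      ∫⁻ x, thinBigCircleMax ψ φ m f x ^ 2 ≤
        ENNReal.ofReal (C * (2 : ℝ) ^ ((m : ℝ) * ((n : ℝ) / 2 - 1)) * ‖f‖) ^ 2 := by
  obtain ⟨B, hB0, hB⟩ := hφ.exists_abs_le
  obtain ⟨C, hC0, hC⟩ := exists_lintegral_iSup_fourierInv_sq_le hn hψ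
  refine ⟨√C * (B + 1), by positivity, fun m f => ?_⟩
  rcases lt_or_ge m (-1) with hm | hm
  · simp [thinBigCircleMax_eq_zero hψ hm]
  have hR : (1 / 2 : ℝ) ≤ 2 ^ m := by
    calc (1 / 2 : ℝ) = 2 ^ (-1 : ℤ) := by norm_num
      _ ≤ 2 ^ m := zpow_le_zpow_right₀ one_le_two hm
  obtain ⟨H, hH, hHint⟩ := hC (2 ^ m) hR _ (measurable_cutoff_mul_fourier hφ f)
    (integrable_cutoff_mul_fourier hφ f) (memLp_cutoff_mul_fourier hφ f)
  have hle : ∀ x, thinBigCircleMax ψ φ m f x ^ 2 ≤ H x := fun x => by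
    have : thinBigCircleMax ψ φ m f x ≤ H x ^ (2 : ℝ)⁻¹ := by
      refine iSup_le fun u => ?_
      have hu : ‖(2 : ℝ) ^ m • (u : EuclideanSpace ℝ (Fin n))‖ = 2 ^ m := by
        rw [norm_smul, mem_sphere_zero_iff_norm.1 u.2, mul_one,
          Real.norm_of_nonneg (by positivity)]
      have h := hH _ hu x
      simp only [real_inner_smul_left] at h
      rwa [localizedMultiplier_eq_fourierInv, ENNReal.le_rpow_inv_iff two_pos,
        ENNReal.rpow_two]
    calc _ ≤ (H x ^ (2 : ℝ)⁻¹) ^ 2 := by gcongr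
      _ = H x := by
        rw [← ENNReal.rpow_natCast, ← ENNReal.rpow_mul]
        norm_num
  have hpow : ((2 : ℝ) ^ m) ^ (n - 2) = ((2 : ℝ) ^ ((m : ℝ) * ((n : ℝ) / 2 - 1))) ^ 2 := by
    rw [← Real.rpow_intCast, ← Real.rpow_natCast, ← Real.rpow_mul two_pos.le,
      ← Real.rpow_natCast, ← Real.rpow_mul two_pos.le, Nat.cast_sub hn]
    congr 1
    push_cast
    ring
  calc _ ≤ ∫⁻ x, H x := lintegral_mono hle
    _ ≤ ENNReal.ofReal (C * ((2 : ℝ) ^ m) ^ (n - 2)) *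
        ENNReal.ofReal ((B + 1) * ‖f‖) ^ 2 := hHint.trans (by
          gcongr
          exact lintegral_cutoff_mul_fourier_sq_le (fun ξ => (hB ξ).trans (by linarith)) f)
    _ = _ := by
      rw [hpow, ← ENNReal.ofReal_pow (by positivity), ← ENNReal.ofReal_pow (by positivity),
        ← ENNReal.ofReal_mul (by positivity)]
      congr 1
      rw [mul_pow, mul_pow, mul_pow, mul_pow, Real.sq_sqrt hC0.le]
      ring

theorem eLpNorm_le_of_lintegral_sq_le {α : Type*} [MeasurableSpace α] {μ : Measure α}
    {T : α → ℝ≥0∞} {A : ℝ≥0∞} (h : ∫⁻ x, T x ^ 2 ∂μ ≤ A ^ 2) : eLpNorm T 2 μ ≤ A := by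
  have e := eLpNorm_nnreal_pow_eq_lintegral (f := T) (μ := μ) (p := 2) two_ne_zero
  simp only [NNReal.coe_ofNat, ENNReal.coe_ofNat, ENNReal.rpow_ofNat, enorm_eq_self] at e
  rw [← e] at h
  exact (ENNReal.pow_le_pow_left_iff two_ne_zero).1 h

theorem exists_l2NormLE_thinBigCircleMax (hn : 2 ≤ n) (hφ : IsAnnulusCutoff φ)
    {ψ : ℝ → ℝ} (hψ : IsAnnulusCutoff ψ) :
    ∃ C : ℝ, 0 < C ∧ ∀ m : ℤ,
      L2NormLE (thinBigCircleMax ψ φ m) (C * (2 : ℝ) ^ ((m : ℝ) * ((n : ℝ) / 2 - 1))) := by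
  obtain ⟨C, hC0, hC⟩ := exists_lintegral_thinBigCircleMax_sq_le hn hφ hψ
  exact ⟨C, hC0, fun m f => ⟨measurable_thinBigCircleMax hφ hψ m f,
    eLpNorm_le_of_lintegral_sq_le (hC m f)⟩⟩

end

/-! ### Dyadic decomposition of the truncated power. -/

/-- A smooth step equal to `1` on `(-∞, 1]` and to `0` on `[2, ∞)`. -/
noncomputable def smoothStep (s : ℝ) : ℝ := Real.smoothTransition (2 - s)

theorem smoothStep_of_le {s : ℝ} (hs : s ≤ 1) : smoothStep s = 1 :=
  Real.smoothTransition.one_of_one_le (by linarith)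

theorem smoothStep_of_ge {s : ℝ} (hs : 2 ≤ s) : smoothStep s = 0 :=
  Real.smoothTransition.zero_of_nonpos (by linarith)

theorem smoothStep_nonneg (s : ℝ) : 0 ≤ smoothStep s := Real.smoothTransition.nonneg _

theorem smoothStep_le_one (s : ℝ) : smoothStep s ≤ 1 := Real.smoothTransition.le_one _

theorem contDiff_smoothStep : ContDiff ℝ ∞ smoothStep :=
  Real.smoothTransition.contDiff.comp (contDiff_const.sub contDiff_id)

/-- The dyadic piece of the truncated power `s₊ ^ δ` at scale one. -/
noncomputable def dyadicPower (δ s : ℝ) : ℝ :=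
  (max s 0) ^ δ * (smoothStep s - smoothStep (2 * s))

theorem isAnnulusCutoff_dyadicPower (δ : ℝ) : IsAnnulusCutoff (dyadicPower δ) where
  contDiff := by
    refine contDiff_iff_contDiffAt.2 fun s => ?_
    rcases lt_or_ge s (1 / 2) with hs | hs
    · refine contDiffAt_const (c := (0 : ℝ)) |>.congr_of_eventuallyEq ?_
      filter_upwards [Iio_mem_nhds hs] with t ht
      have ht : t < 1 / 2 := ht
      rw [dyadicPower, smoothStep_of_le (by linarith), smoothStep_of_le (by linarith), sub_self,
        mul_zero]
    · have hs0 : 0 < s := by linarith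
      have h : ContDiffAt ℝ ∞ (fun t : ℝ => t ^ δ * (smoothStep t - smoothStep (2 * t))) s :=
        (Real.contDiffAt_rpow_const_of_ne hs0.ne').mul
          (contDiff_smoothStep.sub
            (contDiff_smoothStep.comp (contDiff_const.mul contDiff_id))).contDiffAt
      refine h.congr_of_eventuallyEq ?_
      filter_upwards [Ioi_mem_nhds hs0] with t ht
      rw [dyadicPower, max_eq_left (le_of_lt ht)]
  support_subset := by
    intro s hs
    have h1 : 1 / 2 ≤ s := by
      by_contra h
      push Not at h
      exact hs (by rw [dyadicPower, smoothStep_of_le (by linarith),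
        smoothStep_of_le (by linarith), sub_self, mul_zero])
    have h2 : s ≤ 2 := by
      by_contra h
      push Not at h
      exact hs (by rw [dyadicPower, smoothStep_of_ge (by linarith),
        smoothStep_of_ge (by linarith), sub_self, mul_zero])
    have h3 : ‖s‖ = s := Real.norm_of_nonneg (by linarith)
    exact ⟨h1.trans_eq h3.symm, h3.trans_le h2⟩

/-- By homogeneity $2^{-\delta m}$ cancels the scaling of the power, and the differences of steps
telescope. -/
theorem sum_range_dyadicPower (δ t : ℝ) (M : ℕ) :
    ∑ m ∈ Finset.range M, ((2 : ℝ) ^ (-δ)) ^ m * dyadicPower δ ((2 : ℝ) ^ (m : ℤ) * t) =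
      (max t 0) ^ δ * (smoothStep t - smoothStep ((2 : ℝ) ^ M * t)) := by
  have hterm : ∀ m : ℕ, ((2 : ℝ) ^ (-δ)) ^ m * dyadicPower δ ((2 : ℝ) ^ (m : ℤ) * t) =
      (max t 0) ^ δ * (smoothStep ((2 : ℝ) ^ m * t) - smoothStep ((2 : ℝ) ^ (m + 1) * t)) := by
    intro m
    have h1 : max ((2 : ℝ) ^ m * t) 0 = 2 ^ m * max t 0 := by
      rw [mul_max_of_nonneg _ _ (by positivity), mul_zero]
    have h2 : ((2 : ℝ) ^ (-δ)) ^ m * ((2 : ℝ) ^ m) ^ δ = 1 := by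
      rw [← Real.rpow_pow_comm two_pos.le, ← mul_pow, ← Real.rpow_add two_pos]
      simp
    rw [dyadicPower, zpow_natCast, h1, Real.mul_rpow (by positivity) (le_max_right _ _),
      ← mul_assoc, ← mul_assoc, h2, one_mul, ← mul_assoc 2, pow_succ']
  simp only [hterm, ← Finset.mul_sum]
  rw [Finset.sum_range_sub' fun m => smoothStep ((2 : ℝ) ^ m * t)]
  simp

/-- For $0<t\le1$ the sum is stationary once $2^Mt\ge2$. For $t\le0$ every term vanishes, as
$0^\delta=0$ for $\delta>0$. -/
theorem tendsto_sum_range_dyadicPower {δ t : ℝ} (hδ : 0 < δ) (ht : t ≤ 1) :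
    Filter.Tendsto (fun M => ∑ m ∈ Finset.range M,
      ((2 : ℝ) ^ (-δ)) ^ m * dyadicPower δ ((2 : ℝ) ^ (m : ℤ) * t)) Filter.atTop
      (nhds ((max t 0) ^ δ)) := by
  simp only [sum_range_dyadicPower]
  rcases le_or_gt t 0 with h0 | h0
  · simp [max_eq_right h0, Real.zero_rpow hδ.ne']
  · refine tendsto_const_nhds.congr' ?_
    obtain ⟨N, hN⟩ := pow_unbounded_of_one_lt (2 / t) (one_lt_two (α := ℝ))
    filter_upwards [Filter.eventually_ge_atTop N] with M hM
    have h2 : 2 ≤ (2 : ℝ) ^ M * t := by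
      rw [← div_le_iff₀ h0]
      exact hN.le.trans (pow_le_pow_right₀ one_le_two hM)
    rw [smoothStep_of_le ht, smoothStep_of_ge h2, sub_zero, mul_one]

theorem abs_max_rpow_le {δ t : ℝ} (hδ : 0 < δ) (ht : t ≤ 1) : |(max t 0) ^ δ| ≤ 1 := by
  rw [abs_of_nonneg (Real.rpow_nonneg (le_max_right _ _) _)]
  exact Real.rpow_le_one (le_max_right _ _) (max_le ht zero_le_one) hδ.le

theorem abs_sum_range_dyadicPower_le {δ t : ℝ} (hδ : 0 < δ) (ht : t ≤ 1) (M : ℕ) :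
    |∑ m ∈ Finset.range M, ((2 : ℝ) ^ (-δ)) ^ m * dyadicPower δ ((2 : ℝ) ^ (m : ℤ) * t)| ≤ 1 := by
  rw [sum_range_dyadicPower, abs_mul, smoothStep_of_le ht]
  have h := smoothStep_nonneg ((2 : ℝ) ^ M * t)
  have h' := smoothStep_le_one ((2 : ℝ) ^ M * t)
  refine mul_le_one₀ (abs_max_rpow_le hδ ht) (abs_nonneg _) ?_
  rw [abs_le]
  constructor <;> linarith

/-! ### Summation of the dyadic pieces for the smoothed directional Hilbert transform. -/

section

variable {n : ℕ} {φ : EuclideanSpace ℝ (Fin n) → ℝ}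

theorem measurable_dyadicPower_comp (δ : ℝ) (m : ℤ) (u : EuclideanSpace ℝ (Fin n)) :
    Measurable fun ξ : EuclideanSpace ℝ (Fin n) =>
      dyadicPower δ ((2 : ℝ) ^ m * inner ℝ u (‖ξ‖⁻¹ • ξ)) :=
  (isAnnulusCutoff_dyadicPower δ).contDiff.continuous.measurable.comp
    ((measurable_inner_inv_norm_smul u).const_mul _)

theorem measurable_max_inner_rpow (δ : ℝ) (u : EuclideanSpace ℝ (Fin n)) :
    Measurable fun ξ : EuclideanSpace ℝ (Fin n) => (max (inner ℝ u (‖ξ‖⁻¹ • ξ)) 0) ^ δ :=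
  ((measurable_inner_inv_norm_smul u).max measurable_const).pow_const δ

theorem measurable_smoothedDirectionalHilbertMax (hφ : IsAnnulusCutoff φ) {δ : ℝ} (hδ : 0 < δ)
    (f : Lp ℂ 2 (volume : Measure (EuclideanSpace ℝ (Fin n)))) :
    Measurable (smoothedDirectionalHilbertMax φ δ f) :=
  measurable_iSup_localizedMultiplier hφ
    (fun u : Metric.sphere (0 : EuclideanSpace ℝ (Fin n)) 1 =>
      measurable_max_inner_rpow δ (u : EuclideanSpace ℝ (Fin n)))
    (fun u ξ => abs_max_rpow_le hδ
      ((le_abs_self _).trans (abs_inner_inv_norm_smul_le (mem_sphere_zero_iff_norm.1 u.2) ξ))) f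

theorem enorm_localizedMultiplier_sum_le (hφ : IsAnnulusCutoff φ) {ι : Type*} (s : Finset ι)
    {c : ι → ℝ} (hc : ∀ i, 0 ≤ c i) {σ : ι → EuclideanSpace ℝ (Fin n) → ℝ}
    (hσ : ∀ i, Measurable (σ i)) {B : ℝ} (hB : ∀ i ξ, |σ i ξ| ≤ B)
    (f : Lp ℂ 2 (volume : Measure (EuclideanSpace ℝ (Fin n)))) (x : EuclideanSpace ℝ (Fin n)) :
    ‖localizedMultiplier φ (fun ξ => ∑ i ∈ s, c i * σ i ξ) f x‖ₑ ≤
      ∑ i ∈ s, ENNReal.ofReal (c i) * ‖localizedMultiplier φ (σ i) f x‖ₑ := by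
  have hint : ∀ i, Integrable fun ξ => (σ i ξ : ℂ) * (φ ξ : ℂ) * (𝓕 f) ξ *
      Complex.exp (2 * (Real.pi : ℂ) * Complex.I * ((inner ℝ ξ x : ℝ) : ℂ)) := by
    intro i
    have h := (integrable_symbol_mul hφ (hσ i) (hB i) f).mul_bdd (c := 1)
      (measurable_cexp_inner measurable_id (measurable_const (a := x))).aestronglyMeasurable
      (.of_forall fun ξ => (Complex.norm_exp_ofReal_mul_I _).le)
    refine h.congr (.of_forall fun ξ => ?_)
    simp only [id]
    rw [← mul_assoc (σ i ξ : ℂ)]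
    congr 2
    push_cast
    ring
  have heq : localizedMultiplier φ (fun ξ => ∑ i ∈ s, c i * σ i ξ) f x =
      ∑ i ∈ s, (c i : ℂ) * localizedMultiplier φ (σ i) f x := by
    simp only [localizedMultiplier, ← integral_const_mul]
    rw [← integral_finsetSum _ fun i _ => (hint i).const_mul _]
    refine integral_congr_ae (.of_forall fun ξ => ?_)
    simp only [Complex.ofReal_sum, Complex.ofReal_mul, Finset.sum_mul, mul_assoc]
  rw [heq]
  refine (enorm_sum_le _ _).trans_eq (Finset.sum_congr rfl fun i _ => ?_)
  rw [enorm_mul, ← ofReal_norm (c i : ℂ), Complex.norm_real, Real.norm_of_nonneg (hc i)]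

theorem tendsto_localizedMultiplier (hφ : IsAnnulusCutoff φ)
    {σ : ℕ → EuclideanSpace ℝ (Fin n) → ℝ} {τ : EuclideanSpace ℝ (Fin n) → ℝ}
    (hσ : ∀ M, Measurable (σ M)) {B : ℝ} (hB : ∀ M ξ, |σ M ξ| ≤ B)
    (hlim : ∀ ξ, Filter.Tendsto (fun M => σ M ξ) Filter.atTop (nhds (τ ξ)))
    (f : Lp ℂ 2 (volume : Measure (EuclideanSpace ℝ (Fin n)))) (x : EuclideanSpace ℝ (Fin n)) :
    Filter.Tendsto (fun M => localizedMultiplier φ (σ M) f x) Filter.atTop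
      (nhds (localizedMultiplier φ τ f x)) := by
  simp only [localizedMultiplier_eq_fourierInv, Real.fourierInv_eq']
  have hbound := (integrable_cutoff_mul_fourier hφ f).norm.const_mul B
  refine tendsto_integral_of_dominated_convergence _ (fun M => ?_) hbound
    (fun M => .of_forall fun ξ => ?_) (.of_forall fun ξ => ?_)
  · have h1 := measurable_cexp_inner measurable_id (measurable_const (a := x))
    have h2 := (Complex.measurable_ofReal.comp (hσ M)).mul (measurable_cutoff_mul_fourier hφ f)
    exact (h1.smul h2).aestronglyMeasurable
  · rw [smul_eq_mul, norm_mul, Complex.norm_exp_ofReal_mul_I, one_mul, norm_mul,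
      Complex.norm_real]
    gcongr
    exact hB M ξ
  · have h1 := (Complex.continuous_ofReal.tendsto (τ ξ)).comp (hlim ξ)
    have h2 := h1.mul_const ((φ ξ : ℂ) * (𝓕 f) ξ)
    exact h2.const_smul (Complex.exp (((2 * Real.pi * inner ℝ ξ x : ℝ) : ℂ) * Complex.I))

/-- For each fixed $u$ the partial sums of symbols are bounded by 1 and converge pointwise, so
dominated convergence passes the triangle inequality to the limit. -/
theorem smoothedDirectionalHilbertMax_le_tsum (hφ : IsAnnulusCutoff φ) {δ : ℝ} (hδ : 0 < δ)
    (f : Lp ℂ 2 (volume : Measure (EuclideanSpace ℝ (Fin n)))) (x : EuclideanSpace ℝ (Fin n)) :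
    smoothedDirectionalHilbertMax φ δ f x ≤
      ∑' m : ℕ, ENNReal.ofReal (((2 : ℝ) ^ (-δ)) ^ m) *
        thinBigCircleMax (dyadicPower δ) φ m f x := by
  refine iSup_le fun u => ?_
  have hle : ∀ ξ : EuclideanSpace ℝ (Fin n),
      inner ℝ (u : EuclideanSpace ℝ (Fin n)) (‖ξ‖⁻¹ • ξ) ≤ 1 := fun ξ =>
    (le_abs_self _).trans (abs_inner_inv_norm_smul_le (mem_sphere_zero_iff_norm.1 u.2) ξ)
  obtain ⟨B, -, hB⟩ := (isAnnulusCutoff_dyadicPower δ).exists_abs_le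
  have hσ := fun m : ℕ => measurable_dyadicPower_comp δ m (u : EuclideanSpace ℝ (Fin n))
  have hlim := tendsto_localizedMultiplier hφ
    (fun M => Finset.measurable_sum (Finset.range M) fun m _ =>
      (hσ m).const_mul (((2 : ℝ) ^ (-δ)) ^ m))
    (fun M ξ => abs_sum_range_dyadicPower_le hδ (hle ξ) M)
    (fun ξ => tendsto_sum_range_dyadicPower hδ (hle ξ)) f x
  refine le_of_tendsto hlim.enorm (.of_forall fun M => ?_)
  refine (enorm_localizedMultiplier_sum_le hφ (Finset.range M) (fun m => by positivity) hσ
    (fun m ξ => hB _) f x).trans ?_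
  refine le_trans (Finset.sum_le_sum fun m _ => ?_) (ENNReal.sum_le_tsum _)
  gcongr
  exact le_iSup (fun u : Metric.sphere (0 : EuclideanSpace ℝ (Fin n)) 1 =>
    ‖localizedMultiplier φ (fun ξ => dyadicPower δ ((2 : ℝ) ^ (m : ℤ) *
      inner ℝ (u : EuclideanSpace ℝ (Fin n)) (‖ξ‖⁻¹ • ξ))) f x‖ₑ) u

theorem sq_tsum_mul_le (p H : ℕ → ℝ≥0∞) :
    (∑' m, p m * H m) ^ 2 ≤ (∑' m, p m) * ∑' m, p m * H m ^ 2 := by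
  simp only [← lintegral_count]
  exact sq_lintegral_mul_le (measurable_from_nat).aemeasurable (measurable_from_nat).aemeasurable

theorem exists_l2NormLE_smoothedDirectionalHilbertMax (hn : 2 ≤ n) (hφ : IsAnnulusCutoff φ)
    {δ : ℝ} (hδ : (n : ℝ) / 2 - 1 < δ) :
    ∃ C : ℝ, 0 < C ∧ L2NormLE (smoothedDirectionalHilbertMax φ δ) C := by
  have hn' : (2 : ℝ) ≤ n := by exact_mod_cast hn
  have hδ0 : 0 < δ := by linarith
  obtain ⟨C, hC0, hC⟩ := exists_lintegral_thinBigCircleMax_sq_le hn hφ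
    (isAnnulusCutoff_dyadicPower δ)
  set κ : ℝ := (n : ℝ) / 2 - 1 with hκ
  set q : ℝ := (2 : ℝ) ^ (κ - δ) with hq
  set c : ℝ := (2 : ℝ) ^ (-κ) with hc
  have hq0 : 0 < q := by positivity
  have hq1 : q < 1 := Real.rpow_lt_one_of_one_lt_of_neg one_lt_two (by linarith)
  -- The factor $c^m$ normalises the $m$-th operator to norm at most $C$; $q^m$ is the summable
  -- weight used in Cauchy–Schwarz, which costs $(1-q)^{-1}$ in norm.
  have hqc : (2 : ℝ) ^ (-δ) = q * c := by
    rw [hq, hc, ← Real.rpow_add two_pos]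
    congr 1
    ring
  have hsum : ∑' m : ℕ, ENNReal.ofReal (q ^ m) = ENNReal.ofReal (1 - q)⁻¹ := by
    rw [← ENNReal.ofReal_tsum_of_nonneg (fun m => by positivity)
      (summable_geometric_of_lt_one hq0.le hq1), tsum_geometric_of_lt_one hq0.le hq1]
  have hinv : 0 < (1 - q)⁻¹ := inv_pos.2 (by linarith)
  refine ⟨(1 - q)⁻¹ * C, by positivity, fun f =>
    ⟨measurable_smoothedDirectionalHilbertMax hφ hδ0 f, eLpNorm_le_of_lintegral_sq_le ?_⟩⟩
  set T : ℕ → EuclideanSpace ℝ (Fin n) → ℝ≥0∞ := fun m =>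
    thinBigCircleMax (dyadicPower δ) φ m f with hT
  have hTm : ∀ m, Measurable (T m) := fun m =>
    measurable_thinBigCircleMax hφ (isAnnulusCutoff_dyadicPower δ) m f
  have hterm : ∀ m : ℕ, ENNReal.ofReal (c ^ m) ^ 2 * ∫⁻ x, T m x ^ 2 ≤
      ENNReal.ofReal (C * ‖f‖) ^ 2 := fun m => by
    refine (mul_le_mul_right (hC m f) _).trans_eq ?_
    rw [← mul_pow, ← ENNReal.ofReal_mul (by positivity)]
    congr 2
    have : c ^ m * (2 : ℝ) ^ (((m : ℤ) : ℝ) * κ) = 1 := by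
      rw [hc, ← Real.rpow_natCast, ← Real.rpow_mul two_pos.le, ← Real.rpow_add two_pos,
        Int.cast_natCast]
      convert Real.rpow_zero 2 using 2
      ring
    linear_combination (C * ‖f‖) * this
  calc _ ≤ ∫⁻ x, ENNReal.ofReal (1 - q)⁻¹ *
        ∑' m : ℕ, ENNReal.ofReal (q ^ m) * (ENNReal.ofReal (c ^ m) ^ 2 * T m x ^ 2) := by
        refine lintegral_mono fun x => ?_
        calc _ ≤ (∑' m : ℕ, ENNReal.ofReal (q ^ m) * (ENNReal.ofReal (c ^ m) * T m x)) ^ 2 := by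
              refine pow_le_pow_left₀ zero_le
                ((smoothedDirectionalHilbertMax_le_tsum hφ hδ0 f x).trans_eq
                  (tsum_congr fun m => ?_)) 2
              rw [hqc, mul_pow, ENNReal.ofReal_mul (by positivity), mul_assoc]
          _ ≤ _ := by
              refine (sq_tsum_mul_le _ _).trans_eq ?_
              rw [hsum]
              simp only [mul_pow]
    _ = ENNReal.ofReal (1 - q)⁻¹ *
        ∑' m : ℕ, ENNReal.ofReal (q ^ m) * (ENNReal.ofReal (c ^ m) ^ 2 * ∫⁻ x, T m x ^ 2) := by
        have hm : ∀ m, Measurable fun x => ENNReal.ofReal (c ^ m) ^ 2 * T m x ^ 2 := fun m =>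
          ((hTm m).pow_const 2).const_mul _
        rw [lintegral_const_mul _ (Measurable.tsum fun m => (hm m).const_mul _),
          lintegral_tsum fun m => ((hm m).const_mul _).aemeasurable]
        congr 1
        refine tsum_congr fun m => ?_
        rw [lintegral_const_mul _ (hm m), lintegral_const_mul _ ((hTm m).pow_const 2)]
    _ ≤ ENNReal.ofReal (1 - q)⁻¹ *
        ∑' m : ℕ, ENNReal.ofReal (q ^ m) * ENNReal.ofReal (C * ‖f‖) ^ 2 := by
        gcongr with m
        exact hterm m
    _ = _ := by
        rw [ENNReal.tsum_mul_right, hsum, mul_assoc (1 - q)⁻¹, ENNReal.ofReal_mul hinv.le]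
        ring

end

theorem mainTheorem8 (n : ℕ) (hn : 2 ≤ n)
    (φ : EuclideanSpace ℝ (Fin n) → ℝ) (hφ : IsAnnulusCutoff φ) :
    (∀ ψ : ℝ → ℝ, IsAnnulusCutoff ψ →
      ∃ C : ℝ, 0 < C ∧ ∀ m : ℤ,
        L2NormLE (thinBigCircleMax ψ φ m) (C * (2 : ℝ) ^ ((m : ℝ) * ((n : ℝ) / 2 - 1)))) ∧
    (∀ δ : ℝ, (n : ℝ) / 2 - 1 < δ →
      ∃ C : ℝ, 0 < C ∧
        L2NormLE (smoothedDirectionalHilbertMax φ δ) (C * (2 : ℝ) ^ ((n : ℝ) / 2 - 1))) := by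
  refine ⟨fun ψ hψ => exists_l2NormLE_thinBigCircleMax hn hφ hψ, fun δ hδ => ?_⟩
  obtain ⟨C, hC0, hC⟩ := exists_l2NormLE_smoothedDirectionalHilbertMax hn hφ hδ
  -- The constant may depend on $n$, so the factor $2^{n/2-1}$ is absorbed.
  refine ⟨C / (2 : ℝ) ^ ((n : ℝ) / 2 - 1), by positivity, ?_⟩
  rwa [div_mul_cancel₀ _ (by positivity)]
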